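/- A Kleene algebra with tests (KAT) consists of a Kleene algebra $\langle X,\cdot,+,{\cdot}^\star,1,0\rangle$ (an idempotent semiring, ordered by $x\le y \iff x+y=y$, with a unary operation ${}^\star$ such that $1+x\cdot x^\star\le x^\star$, that $y\cdot x\le x$ implies $y^\star\cdot x\le x$, and that $x\cdot y\le x$ implies $x\cdot y^\star\le x$), a Boolean algebra $\langle B,\wedge,\vee,\neg,\top,\bot\rangle$, and a map $[\cdot]:B\to X$ with $[a\wedge b]=[a]\cdot[b]$, $[a\vee b]=[a]+[b]$, $[\top]=1$ and $[\bot]=0$. Let $\Sigma$ be a set of letters and $\Theta$ a finite set of primitive tests. Boolean expressions $a,b$ and KAT expressions $x,y$ are given by $$a,b ::= t\in\Theta \mid a\wedge b\mid a\vee b\mid \neg a\mid\top\mid\bot, \qquad x,y ::= p\in\Sigma\mid [a]\mid x\cdot y\mid x+y\mid x^\star\mid 1\mid 0.$$ Any pair of maps $\theta:\Theta\to B$, $\sigma:\Sigma\to X$ into a KAT interprets Boolean expressions in $B$ and KAT expressions in $X$, homomorphically. Write $\mathsf{KAT}\vdash x=y$ if $x$ and $y$ have the same interpretation in every Kleene algebra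 with tests, for all $\theta$ and $\sigma$. An atom is a function $\alpha:\Theta\to\{\mathrm{true},\mathrm{false}\}$; let $At$ be the set of atoms. A guarded string is a sequence $\alpha_1p_1\cdots\alpha_np_n\alpha_{n+1}$ with $n\ge 0$, $\alpha_i\in At$ and $p_i\in\Sigma$. The concatenation $u\ast v$ of guarded strings is defined only if the last atom of $u$ equals the first atom of $v$, and is then the concatenation of the two sequences with the shared atom written once. Sets of guarded strings form a KAT whose tests are the sets of atoms (with the usual Boolean operations): $L\cdot M=\{u\ast v\mid u\in L,\ v\in M,\ u\ast v \text{ defined}\}$, $L+M=L\cup M$, $1=At$ (atoms viewed as guarded strings with $n=0$), $0=\emptyset$, $L^\star=\bigcup_{n\ge0}L^n$ with $L^0=1$, and $[a]=\{\alpha\mid\alpha\in a\}$. Let $G(x)$ be the interpretation of $x$ in this KAT under $t\mapsto\{\alpha\in At\mid\alpha(t)\text{ is true}\}$ for $t\in\Theta$ and $p\mapsto\{\alpha p\beta\mid\alpha,\beta\in At\}$ for $p\in\Sigma$. **Theorem (KAT completeness).** For all KAT expressions $x,y$ over $\Sigma$ and $\Theta$, if $G(x)=G(y)$ then $\mathsf{KAT}\vdash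 x=y$. -/

import Mathlib

universe u v w z

namespace KAT

/-! ### Kleene algebras with tests -/

/-- A Kleene algebra with tests on a Kleene algebra `X` and a Boolean algebra `B`: a homomorphism
`[·] : B → X` from `(B, ∧, ∨, ⊤, ⊥)` to `(X, ·, +, 1, 0)`. -/
structure KleeneAlgebraWithTests (X : Type*) (B : Type*) [KleeneAlgebra X] [BooleanAlgebra B] where
  /-- The embedding `[·]` of tests. -/
  test : B → X
  test_inf : ∀ a b : B, test (a ⊓ b) = test a * test b
  test_sup : ∀ a b : B, test (a ⊔ b) = test a + test b
  test_top : test ⊤ = 1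
  test_bot : test ⊥ = 0

/-! ### Expressions and their interpretation -/

/-- Boolean expressions over a set `Θ` of primitive tests. -/
inductive BExpr (Θ : Type*) where
  | prim : Θ → BExpr Θ
  | and : BExpr Θ → BExpr Θ → BExpr Θ
  | or : BExpr Θ → BExpr Θ → BExpr Θ
  | not : BExpr Θ → BExpr Θ
  | top : BExpr Θ
  | bot : BExpr Θ

/-- KAT expressions over a set `Sig` of letters and a set `Θ` of primitive tests. -/
inductive KExpr (Sig : Type*) (Θ : Type*) where
  | letter : Sig → KExpr Sig Θ
  | test : BExpr Θ → KExpr Sig Θ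
  | mul : KExpr Sig Θ → KExpr Sig Θ → KExpr Sig Θ
  | add : KExpr Sig Θ → KExpr Sig Θ → KExpr Sig Θ
  | star : KExpr Sig Θ → KExpr Sig Θ
  | one : KExpr Sig Θ
  | zero : KExpr Sig Θ

/-- The interpretation of Boolean expressions in a Boolean algebra induced by `θ : Θ → B`. -/
def BExpr.eval {Θ B : Type*} [BooleanAlgebra B] (θ : Θ → B) : BExpr Θ → B
  | .prim t => θ t
  | .and a b => a.eval θ ⊓ b.eval θ
  | .or a b => a.eval θ ⊔ b.eval θ
  | .not a => (a.eval θ)ᶜ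
  | .top => ⊤
  | .bot => ⊥

/-- The interpretation of KAT expressions in a Kleene algebra with tests `K` induced by
`θ : Θ → B` and `σ : Sig → X`. -/
def KExpr.eval {Sig Θ X B : Type*} [KleeneAlgebra X] [BooleanAlgebra B]
    (K : KleeneAlgebraWithTests X B) (θ : Θ → B) (σ : Sig → X) : KExpr Sig Θ → X
  | .letter p => σ p
  | .test a => K.test (a.eval θ)
  | .mul x y => x.eval K θ σ * y.eval K θ σ
  | .add x y => x.eval K θ σ + y.eval K θ σ
  | .star x => KStar.kstar (x.eval K θ σ)
  | .one => 1
  | .zero => 0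

/-- `KAT ⊢ x = y`: the equation `x = y` holds in any Kleene algebra with tests, under any
interpretation (the sorts of the algebra range over the universes `w` and `z`). -/
def IsTheorem {Sig : Type u} {Θ : Type v} (x y : KExpr Sig Θ) : Prop :=
  ∀ (X : Type w) (B : Type z) [KleeneAlgebra X] [BooleanAlgebra B]
    (K : KleeneAlgebraWithTests X B) (θ : Θ → B) (σ : Sig → X),
    x.eval K θ σ = y.eval K θ σ

/-! ### Guarded strings -/

/-- Atoms: truth assignments to the primitive tests. -/
abbrev Atom (Θ : Type*) := Θ → Bool

/-- Guarded strings `α₁ p₁ … αₙ pₙ αₙ₊₁`, as elements of `(At × Sig)⋆ × At`. -/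
abbrev GString (Sig : Type*) (Θ : Type*) := List (Atom Θ × Sig) × Atom Θ

namespace GString

variable {Sig Θ : Type*}

/-- The first atom of a guarded string. -/
def first : GString Sig Θ → Atom Θ
  | ([], α) => α
  | ((α, _) :: _, _) => α

/-- The last atom of a guarded string. -/
def last (u : GString Sig Θ) : Atom Θ := u.2

/-- The partial concatenation `u ∗ v`: defined only if the last atom of `u` is the first atom of
`v`, and then the concatenation of the two sequences without repeating the shared atom. -/
def concat (u v : GString Sig Θ) : Part (GString Sig Θ) :=
  ⟨last u = first v, fun _ => (u.1 ++ v.1, v.2)⟩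

theorem mem_concat {u v w : GString Sig Θ} :
    w ∈ concat u v ↔ last u = first v ∧ (u.1 ++ v.1, v.2) = w :=
  ⟨fun ⟨h, e⟩ => ⟨h, e⟩, fun ⟨h, e⟩ => ⟨h, e⟩⟩

theorem first_append (l : List (Atom Θ × Sig)) (v : GString Sig Θ) :
    first (l ++ v.1, v.2) = first (l, first v) := by
  cases l <;> rfl

end GString

/-- Guarded string languages. -/
def GLang (Sig : Type*) (Θ : Type*) := Set (GString Sig Θ)

namespace GLang

variable {Sig Θ : Type*}

instance : Membership (GString Sig Θ) (GLang Sig Θ) := ⟨Set.Mem⟩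

instance : Zero (GLang Sig Θ) := ⟨(∅ : Set (GString Sig Θ))⟩

/-- `1` is the set of guarded strings reduced to an atom. -/
instance : One (GLang Sig Θ) := ⟨{w : GString Sig Θ | ∃ α : Atom Θ, w = ([], α)}⟩

instance : Add (GLang Sig Θ) :=
  ⟨fun L M => ((L : Set (GString Sig Θ)) ∪ (M : Set (GString Sig Θ)) : Set (GString Sig Θ))⟩

/-- The product is the set of all defined concatenations `u ∗ v` with `u ∈ L` and `v ∈ M`. -/
instance : Mul (GLang Sig Θ) :=
  ⟨fun L M => {w : GString Sig Θ | ∃ u ∈ L, ∃ v ∈ M, w ∈ GString.concat u v}⟩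

theorem ext {L M : GLang Sig Θ} (h : ∀ w : GString Sig Θ, w ∈ L ↔ w ∈ M) : L = M := Set.ext h

theorem not_mem_zero (w : GString Sig Θ) : ¬ w ∈ (0 : GLang Sig Θ) := id

theorem mem_one {w : GString Sig Θ} : w ∈ (1 : GLang Sig Θ) ↔ ∃ α : Atom Θ, w = ([], α) := Iff.rfl

theorem mem_add {L M : GLang Sig Θ} {w : GString Sig Θ} : w ∈ L + M ↔ w ∈ L ∨ w ∈ M := Iff.rfl

theorem mem_mul {L M : GLang Sig Θ} {w : GString Sig Θ} :
    w ∈ L * M ↔ ∃ u ∈ L, ∃ v ∈ M, w ∈ GString.concat u v := Iff.rfl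

theorem one_mul' (L : GLang Sig Θ) : 1 * L = L := by
  refine ext fun w => ⟨?_, fun h => ?_⟩
  · rintro ⟨_, ⟨α, rfl⟩, v, hv, h⟩
    obtain ⟨-, rfl⟩ := GString.mem_concat.1 h
    exact hv
  · exact ⟨([], w.first), ⟨_, rfl⟩, w, h, GString.mem_concat.2 ⟨rfl, rfl⟩⟩

theorem mul_one' (L : GLang Sig Θ) : L * 1 = L := by
  refine ext fun w => ⟨?_, fun h => ?_⟩
  · rintro ⟨u, hu, _, ⟨α, rfl⟩, h⟩
    obtain ⟨rfl, rfl⟩ := GString.mem_concat.1 h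
    rw [List.append_nil]
    exact hu
  · exact ⟨w, h, ([], w.2), ⟨_, rfl⟩, GString.mem_concat.2 ⟨rfl, by rw [List.append_nil]⟩⟩

theorem mul_assoc' (L M N : GLang Sig Θ) : L * M * N = L * (M * N) := by
  refine ext fun w => ⟨?_, ?_⟩
  · rintro ⟨_, ⟨u, hu, v, hv, h₁⟩, t, ht, h₂⟩
    obtain ⟨e₁, rfl⟩ := GString.mem_concat.1 h₁
    obtain ⟨e₂, rfl⟩ := GString.mem_concat.1 h₂
    refine ⟨u, hu, (v.1 ++ t.1, t.2), ⟨v, hv, t, ht, GString.mem_concat.2 ⟨e₂, rfl⟩⟩,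
      GString.mem_concat.2 ⟨?_, by rw [List.append_assoc]⟩⟩
    rw [e₁, GString.first_append, ← e₂]
    rfl
  · rintro ⟨u, hu, _, ⟨v, hv, t, ht, h₁⟩, h₂⟩
    obtain ⟨e₁, rfl⟩ := GString.mem_concat.1 h₁
    obtain ⟨e₂, rfl⟩ := GString.mem_concat.1 h₂
    rw [GString.first_append, ← e₁] at e₂
    exact ⟨(u.1 ++ v.1, v.2), ⟨u, hu, v, hv, GString.mem_concat.2 ⟨e₂, rfl⟩⟩, t, ht,
      GString.mem_concat.2 ⟨e₁, by rw [List.append_assoc]⟩⟩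

instance : Semiring (GLang Sig Θ) where
  add_assoc _ _ _ := Set.union_assoc _ _ _
  zero_add _ := Set.empty_union _
  add_zero _ := Set.union_empty _
  add_comm _ _ := Set.union_comm _ _
  nsmul := nsmulRec
  zero_mul _ := ext fun w => ⟨fun ⟨_, h, _⟩ => h.elim, fun h => h.elim⟩
  mul_zero _ := ext fun w => ⟨fun ⟨_, _, _, h, _⟩ => h.elim, fun h => h.elim⟩
  one_mul := one_mul'
  mul_one := mul_one'
  mul_assoc := mul_assoc'
  left_distrib L M N := ext fun w => by
    simp only [mem_mul, mem_add]
    constructor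
    · rintro ⟨u, hu, v, hv | hv, h⟩
      exacts [.inl ⟨u, hu, v, hv, h⟩, .inr ⟨u, hu, v, hv, h⟩]
    · rintro (⟨u, hu, v, hv, h⟩ | ⟨u, hu, v, hv, h⟩)
      exacts [⟨u, hu, v, .inl hv, h⟩, ⟨u, hu, v, .inr hv, h⟩]
  right_distrib L M N := ext fun w => by
    simp only [mem_mul, mem_add]
    constructor
    · rintro ⟨u, hu | hu, v, hv, h⟩
      exacts [.inl ⟨u, hu, v, hv, h⟩, .inr ⟨u, hu, v, hv, h⟩]
    · rintro (⟨u, hu, v, hv, h⟩ | ⟨u, hu, v, hv, h⟩)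
      exacts [⟨u, .inl hu, v, hv, h⟩, ⟨u, .inr hu, v, hv, h⟩]

/-- The order is inclusion of languages. -/
instance : IdemSemiring (GLang Sig Θ) where
  le L M := ∀ w : GString Sig Θ, w ∈ L → w ∈ M
  le_refl _ _ h := h
  le_trans _ _ _ h₁ h₂ w h := h₂ w (h₁ w h)
  le_antisymm _ _ h₁ h₂ := ext fun w => ⟨h₁ w, h₂ w⟩
  sup L M := L + M
  le_sup_left _ _ _ h := .inl h
  le_sup_right _ _ _ h := .inr h
  sup_le _ _ _ h₁ h₂ w h := h.elim (h₁ w) (h₂ w)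
  bot := 0
  bot_le _ _ h := h.elim
  add_eq_sup _ _ := rfl

theorem le_def {L M : GLang Sig Θ} : L ≤ M ↔ ∀ w : GString Sig Θ, w ∈ L → w ∈ M := Iff.rfl

/-- The star of `L` is the set of all defined concatenations `u₁ ∗ ⋯ ∗ uₙ` of `n ≥ 0` elements
of `L`, that is, the union of the powers of `L` (with `L ^ 0 = 1`). -/
instance : KStar (GLang Sig Θ) := ⟨fun L => {w : GString Sig Θ | ∃ n : ℕ, w ∈ L ^ n}⟩

theorem mem_kstar {L : GLang Sig Θ} {w : GString Sig Θ} :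
    w ∈ KStar.kstar L ↔ ∃ n : ℕ, w ∈ L ^ n := Iff.rfl

instance : KleeneAlgebra (GLang Sig Θ) where
  one_le_kstar L := le_def.2 fun w h => ⟨0, by rwa [pow_zero]⟩
  mul_kstar_le_kstar L := le_def.2 fun w => by
    rintro ⟨u, hu, v, ⟨n, hv⟩, h⟩
    exact ⟨n + 1, by rw [pow_succ']; exact ⟨u, hu, v, hv, h⟩⟩
  kstar_mul_le_kstar L := le_def.2 fun w => by
    rintro ⟨u, ⟨n, hu⟩, v, hv, h⟩
    exact ⟨n + 1, by rw [pow_succ]; exact ⟨u, hu, v, hv, h⟩⟩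
  mul_kstar_le_self L M hM := le_def.2 fun w => by
    have key : ∀ n : ℕ, M * L ^ n ≤ M := fun n => by
      induction n with
      | zero => rw [pow_zero, mul_one]
      | succ n ih =>
        rw [pow_succ, ← mul_assoc]
        exact (mul_le_mul_left ih L).trans hM
    rintro ⟨u, hu, v, ⟨n, hv⟩, h⟩
    exact le_def.1 (key n) w ⟨u, hu, v, hv, h⟩
  kstar_mul_le_self L M hM := le_def.2 fun w => by
    have key : ∀ n : ℕ, L ^ n * M ≤ M := fun n => by
      induction n with
      | zero => rw [pow_zero, one_mul]
      | succ n ih =>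
        rw [pow_succ', mul_assoc]
        exact (mul_le_mul_right ih L).trans hM
    rintro ⟨u, ⟨n, hu⟩, v, hv, h⟩
    exact le_def.1 (key n) w ⟨u, hu, v, hv, h⟩

/-- The Kleene algebra with tests of guarded string languages: tests are sets of atoms, and
`[a]` is the set of guarded strings reduced to an atom of `a`. -/
def model (Sig Θ : Type*) : KleeneAlgebraWithTests (GLang Sig Θ) (Set (Atom Θ)) where
  test a := {w : GString Sig Θ | ∃ α ∈ a, w = ([], α)}
  test_inf a b := ext fun w => by
    constructor
    · rintro ⟨α, ⟨ha, hb⟩, rfl⟩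
      exact ⟨([], α), ⟨α, ha, rfl⟩, ([], α), ⟨α, hb, rfl⟩, GString.mem_concat.2 ⟨rfl, rfl⟩⟩
    · rintro ⟨_, ⟨α, ha, rfl⟩, _, ⟨β, hb, rfl⟩, h⟩
      obtain ⟨e, rfl⟩ := GString.mem_concat.1 h
      obtain rfl : α = β := e
      exact ⟨α, ⟨ha, hb⟩, rfl⟩
  test_sup a b := ext fun w => by
    constructor
    · rintro ⟨α, ha | hb, rfl⟩
      exacts [.inl ⟨α, ha, rfl⟩, .inr ⟨α, hb, rfl⟩]
    · rintro (⟨α, ha, rfl⟩ | ⟨α, hb, rfl⟩)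
      exacts [⟨α, .inl ha, rfl⟩, ⟨α, .inr hb, rfl⟩]
  test_top := ext fun w => ⟨fun ⟨α, _, h⟩ => ⟨α, h⟩, fun ⟨α, h⟩ => ⟨α, trivial, h⟩⟩
  test_bot := ext fun w => ⟨fun ⟨_, h, _⟩ => h.elim, fun h => h.elim⟩

end GLang

/-- The guarded string language `G(x)` of a KAT expression: the interpretation in the model of
guarded string languages with `G(aᵢ) = {α | α(aᵢ) is true}` and `G(p) = {α p β | α, β ∈ At}`. -/
def G {Sig Θ : Type*} (x : KExpr Sig Θ) : GLang Sig Θ :=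
  x.eval (GLang.model Sig Θ) (fun t => {α : Atom Θ | α t = true})
    (fun p => {w : GString Sig Θ | ∃ α β : Atom Θ, w = ([(α, p)], β)})

end KAT

namespace KAT

open Computability

/-! ### Finite sums as joins -/

section Sums

variable {X : Type*} [IdemSemiring X]

/-! By antisymmetry it suffices that `G x ≤ G y` gives `x ≤ y` in an arbitrary algebra `K`; the
argument runs inside `K`, with no appeal to completeness of plain Kleene algebra. Finitely many
elements of `K`, playing the role of partial derivatives of `y`, suffice to read every guarded
string of `G y` below the value of `y` (`exists_finite_run`). The powerset construction on them
gives a finite deterministic automaton with transition matrix `N` over the letters of `x`; let `R`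
be its reflexive transitive closure. Two facts about `R` conclude. Cut at atoms, `x` is covered by
the entries of `R` from the start state to the states reached by strings of `G x`
(`mul_eval_mul_le`). The vector sending a state `d` to the sum of its elements satisfies `N v ≤ v`
(`mul_sum_derivStep_le`), hence `R v ≤ v`. A string of `G x` ending in `β` is also in `G y`, so `β`
lies below the sum of the state it reaches (`Run.atom_le_sum_foldl`), and the corresponding part of
`x` lies below `y`. -/

theorem sum_le_of_forall_le {ι : Type*} {s : Finset ι} {f : ι → X} {c : X}
    (h : ∀ i ∈ s, f i ≤ c) : ∑ i ∈ s, f i ≤ c := by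
  classical
  induction s using Finset.induction_on with
  | empty => simp
  | insert i s hi ih =>
    rw [Finset.sum_insert hi]
    exact add_le (h i (Finset.mem_insert_self i s))
      (ih fun j hj => h j (Finset.mem_insert_of_mem hj))

theorem le_sum_of_mem {ι : Type*} {s : Finset ι} (f : ι → X) {i : ι} (hi : i ∈ s) :
    f i ≤ ∑ j ∈ s, f j :=
  Finset.single_le_sum_of_canonicallyOrdered hi

end Sums

/-! ### Reflexive transitive closure of a finite matrix -/

section Closure

variable {X Q : Type*} [KleeneAlgebra X]

/-- The entries of the transitive closure of `N` restricted to paths all of whose intermediate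
indices belong to a given list, computed by Kleene's algorithm. -/
def pathsThrough (N : Q → Q → X) : List Q → Q → Q → X
  | [], i, j => N i j
  | k :: l, i, j =>
    pathsThrough N l i j + pathsThrough N l i k * (pathsThrough N l k k)∗ * pathsThrough N l k j

theorem le_pathsThrough (N : Q → Q → X) (l : List Q) (i j : Q) :
    N i j ≤ pathsThrough N l i j := by
  induction l with
  | nil => exact le_rfl
  | cons k l ih => exact ih.trans le_self_add

/-- Concatenating at `j` only adds `j` as an intermediate index, which is already allowed. -/
theorem pathsThrough_mul_le (N : Q → Q → X) (l : List Q) (i j k : Q) (hj : j ∈ l) :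
    pathsThrough N l i j * pathsThrough N l j k ≤ pathsThrough N l i k := by
  induction l generalizing i j k with
  | nil => simp at hj
  | cons m l ih =>
    simp only [pathsThrough]
    set P := pathsThrough N l
    have star_mul : (P m m)∗ * P m m ≤ (P m m)∗ := kstar_mul_le_kstar
    have mul_star : P m m * (P m m)∗ ≤ (P m m)∗ := mul_kstar_le_kstar
    have main : P i m * (P m m)∗ * P m k ≤ P i k + P i m * (P m m)∗ * P m k := le_add_self
    -- If `j` is the newest index, the star at `j` absorbs the junction. Otherwise the product
    -- expands into four terms, and the induction hypothesis removes `j` from each.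
    rcases List.mem_cons.1 hj with rfl | hj
    · have left : P i j + P i j * (P j j)∗ * P j j ≤ P i j * (P j j)∗ := by
        refine add_le (le_mul_of_one_le_right' one_le_kstar) ?_
        rw [mul_assoc]
        gcongr
      have right : P j k + P j j * (P j j)∗ * P j k ≤ (P j j)∗ * P j k := by
        refine add_le (le_mul_of_one_le_left' one_le_kstar) ?_
        gcongr
      refine (mul_le_mul' left right).trans (le_trans (le_of_eq ?_) main)
      rw [mul_assoc, ← mul_assoc (P j j)∗, kstar_mul_kstar, mul_assoc]
    · have h₁ := ih i j k hj
      have h₂ := ih i j m hj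
      have h₃ := ih m j k hj
      have h₄ := ih m j m hj
      rw [add_mul, mul_add, mul_add]
      refine add_le (add_le (h₁.trans le_self_add) (le_trans ?_ main))
        (add_le (le_trans ?_ main) (le_trans ?_ main))
      · rw [← mul_assoc, ← mul_assoc]
        gcongr
      · rw [mul_assoc]
        gcongr
      · calc P i m * (P m m)∗ * P m j * (P j m * (P m m)∗ * P m k)
            = P i m * (P m m)∗ * (P m j * P j m) * (P m m)∗ * P m k := by
              simp only [mul_assoc]
          _ ≤ P i m * (P m m)∗ * P m m * (P m m)∗ * P m k := by gcongr
          _ ≤ P i m * (P m m)∗ * (P m m)∗ * P m k := by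
              rw [mul_assoc (P i m)]
              gcongr
          _ = P i m * (P m m)∗ * P m k := by rw [mul_assoc (P i m), kstar_mul_kstar]

theorem pathsThrough_mul_le_of_forall_mul_le {N : Q → Q → X} {v : Q → X}
    (h : ∀ i j, N i j * v j ≤ v i) (l : List Q) (i j : Q) : pathsThrough N l i j * v j ≤ v i := by
  induction l generalizing i j with
  | nil => exact h i j
  | cons k l ih =>
    rw [pathsThrough, add_mul]
    refine add_le (ih i j) ?_
    rw [mul_assoc, mul_assoc]
    calc _ ≤ pathsThrough N l i k * ((pathsThrough N l k k)∗ * v k) := by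
          gcongr
          exact ih k j
      _ ≤ pathsThrough N l i k * v k := by
          gcongr
          exact kstar_mul_le_self (ih k k)
      _ ≤ v i := ih i k

/-- Leastness is only needed, and only stated, as induction against column vectors. -/
theorem exists_reflTransClosure [Finite Q] (N : Q → Q → X) :
    ∃ R : Q → Q → X, (∀ i, 1 ≤ R i i) ∧ (∀ i j, N i j ≤ R i j) ∧
      (∀ i j k, R i j * R j k ≤ R i k) ∧
      ∀ v : Q → X, (∀ i j, N i j * v j ≤ v i) → ∀ i j, R i j * v j ≤ v i := by
  classical
  cases nonempty_fintype Q
  -- Adding the identity matrix makes the transitive closure reflexive.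
  let N' : Q → Q → X := fun i j => N i j + if i = j then 1 else 0
  let l : List Q := Finset.univ.toList
  have hN : ∀ i j, N' i j ≤ pathsThrough N' l i j := le_pathsThrough N' l
  refine ⟨pathsThrough N' l, fun i => le_trans ?_ (hN i i), fun i j => le_trans ?_ (hN i j),
    fun i j k => pathsThrough_mul_le N' l i j k (by simp [l]),
    fun v hv => pathsThrough_mul_le_of_forall_mul_le (fun i j => ?_) l⟩
  · simp only [N', if_pos]
    exact le_add_self
  · exact le_self_add
  · simp only [N', add_mul]
    refine add_le (hv i j) ?_
    split_ifs with h
    · rw [one_mul, h]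
    · simp

end Closure

/-! ### Atoms as elements of a Kleene algebra with tests -/

section Atoms

variable {Θ B : Type*} [BooleanAlgebra B] [Fintype Θ]

/-- The conjunction of literals described by an atom. -/
def atomInf (θ : Θ → B) (α : Atom Θ) : B :=
  Finset.univ.inf fun t => if α t then θ t else (θ t)ᶜ

theorem atomInf_le_lit (θ : Θ → B) (α : Atom Θ) (t : Θ) :
    atomInf θ α ≤ if α t then θ t else (θ t)ᶜ :=
  Finset.inf_le (f := fun t => if α t then θ t else (θ t)ᶜ) (Finset.mem_univ t)

theorem atomInf_inf_of_ne (θ : Θ → B) {α β : Atom Θ} (h : α ≠ β) :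
    atomInf θ α ⊓ atomInf θ β = ⊥ := by
  obtain ⟨t, ht⟩ := Function.ne_iff.1 h
  refine le_bot_iff.1 ((inf_le_inf (atomInf_le_lit θ α t) (atomInf_le_lit θ β t)).trans ?_)
  cases hα : α t <;> cases hβ : β t <;> simp_all

/-- An atom decides every Boolean expression. Both halves are proved together because negation
exchanges them. -/
theorem atomInf_le_eval (θ : Θ → B) (α : Atom Θ) (b : BExpr Θ) :
    (α ∈ b.eval (fun t => {α : Atom Θ | α t = true}) → atomInf θ α ≤ b.eval θ) ∧
      (α ∉ b.eval (fun t => {α : Atom Θ | α t = true}) → atomInf θ α ≤ (b.eval θ)ᶜ) := by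
  induction b with
  | prim t =>
    have := atomInf_le_lit θ α t
    simp only [BExpr.eval, Set.mem_ofPred_eq]
    constructor <;> intro h <;> simpa [h] using this
  | and a b iha ihb =>
    simp only [BExpr.eval, Set.inf_eq_inter, Set.mem_inter_iff, compl_inf]
    refine ⟨fun h => le_inf (iha.1 h.1) (ihb.1 h.2), fun h => ?_⟩
    rcases not_and_or.1 h with h | h
    exacts [(iha.2 h).trans le_sup_left, (ihb.2 h).trans le_sup_right]
  | or a b iha ihb =>
    simp only [BExpr.eval, Set.sup_eq_union, Set.mem_union, compl_sup]
    refine ⟨?_, fun h => le_inf (iha.2 (not_or.1 h).1) (ihb.2 (not_or.1 h).2)⟩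
    rintro (h | h)
    exacts [(iha.1 h).trans le_sup_left, (ihb.1 h).trans le_sup_right]
  | not a iha =>
    simp only [BExpr.eval, Set.mem_compl_iff, compl_compl, not_not]
    exact ⟨iha.2, iha.1⟩
  | top => simp [BExpr.eval]
  | bot => simp [BExpr.eval]

theorem sup_atomInf [DecidableEq Θ] (θ : Θ → B) : Finset.univ.sup (atomInf θ) = ⊤ := by
  -- Primitive tests are eliminated one at a time: the two values at `t` join to `⊤`. Values of `α`
  -- outside `s` play no role.
  have key : ∀ (s : Finset Θ) (c : B),
      (∀ α : Atom Θ, (s.inf fun t => if α t then θ t else (θ t)ᶜ) ≤ c) → ⊤ ≤ c := by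
    intro s
    induction s using Finset.induction_on with
    | empty => exact fun c h => h fun _ => true
    | insert t s ht ih =>
      refine fun c h => ih c fun α => ?_
      have split : ∀ b : Bool, (if b then θ t else (θ t)ᶜ) ⊓
          (s.inf fun t => if α t then θ t else (θ t)ᶜ) ≤ c := fun b => by
        refine le_of_eq_of_le ?_ (h (Function.update α t b))
        rw [Finset.inf_insert, Function.update_self]
        refine congrArg _ (Finset.inf_congr rfl fun u hu => ?_)
        rw [Function.update_of_ne (ne_of_mem_of_not_mem hu ht)]
      have := sup_le (split true) (split false)
      rwa [← inf_sup_right, if_pos rfl, if_neg Bool.false_ne_true, sup_compl_eq_top,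
        top_inf_eq] at this
  exact top_le_iff.1 (key Finset.univ _ fun α => Finset.le_sup (f := atomInf θ) (Finset.mem_univ α))

namespace KleeneAlgebraWithTests

variable {X : Type*} [KleeneAlgebra X] (K : KleeneAlgebraWithTests X B)

theorem test_finset_sup {ι : Type*} (s : Finset ι) (f : ι → B) :
    K.test (s.sup f) = ∑ i ∈ s, K.test (f i) := by
  classical
  induction s using Finset.induction_on with
  | empty => simp [K.test_bot]
  | insert i s hi ih => rw [Finset.sup_insert, Finset.sum_insert hi, K.test_sup, ih]

theorem test_le_one (a : B) : K.test a ≤ 1 := by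
  rw [← K.test_top, ← sup_top_eq a, K.test_sup]
  exact le_self_add

/-- The interpretation of an atom. -/
def atom (θ : Θ → B) (α : Atom Θ) : X := K.test (atomInf θ α)

variable (θ : Θ → B)

theorem atom_le_one (α : Atom Θ) : K.atom θ α ≤ 1 := K.test_le_one _

theorem atom_mul_self (α : Atom Θ) : K.atom θ α * K.atom θ α = K.atom θ α := by
  rw [atom, ← K.test_inf, inf_idem]

theorem atom_mul_of_ne {α β : Atom Θ} (h : α ≠ β) : K.atom θ α * K.atom θ β = 0 := by
  rw [atom, atom, ← K.test_inf, atomInf_inf_of_ne θ h, K.test_bot]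

theorem sum_atom [DecidableEq Θ] : ∑ α, K.atom θ α = 1 := by
  rw [← K.test_top, ← sup_atomInf θ, K.test_finset_sup]
  rfl

theorem atom_le_test (α : Atom Θ) (b : BExpr Θ)
    (h : α ∈ b.eval (fun t => {α : Atom Θ | α t = true})) :
    K.atom θ α ≤ K.test (b.eval θ) := by
  rw [atom, ← sup_eq_right.2 ((atomInf_le_eval θ α b).1 h), K.test_sup]
  exact le_self_add

theorem atom_mul_test_of_notMem (α : Atom Θ) (b : BExpr Θ)
    (h : α ∉ b.eval (fun t => {α : Atom Θ | α t = true})) :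
    K.atom θ α * K.test (b.eval θ) = 0 := by
  rw [atom, ← K.test_inf, (le_compl_iff_disjoint_right.1 ((atomInf_le_eval θ α b).2 h)).eq_bot,
    K.test_bot]

theorem mul_le_of_forall_atom {a b c : X} (h : ∀ α, a * K.atom θ α * b ≤ c) : a * b ≤ c := by
  classical
  rw [← mul_one a, ← K.sum_atom θ, Finset.mul_sum, Finset.sum_mul]
  exact sum_le_of_forall_le fun α _ => h α

end KleeneAlgebraWithTests

end Atoms

/-! ### Finitely many derivatives suffice to read the guarded strings of an expression -/

section Runs

variable {Sig Θ B X : Type*} [BooleanAlgebra B] [Fintype Θ] [KleeneAlgebra X]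
  (K : KleeneAlgebraWithTests X B) (θ : Θ → B) (σ : Sig → X)

/-- The guarded string `l β` can be read below `x`, going through elements of `S`. -/
def Run (S : Set X) : X → List (Atom Θ × Sig) → Atom Θ → Prop
  | x, [], β => K.atom θ β ≤ x
  | x, (α, p) :: l, β => ∃ y ∈ S, K.atom θ α * σ p * y ≤ x ∧ Run S y l β

variable {K θ σ}

theorem Run.mono {S T : Set X} (hST : S ⊆ T) {x y : X} (hxy : x ≤ y)
    {l : List (Atom Θ × Sig)} {β : Atom Θ} (h : Run K θ σ S x l β) : Run K θ σ T y l β := by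
  induction l generalizing x y with
  | nil => exact le_trans h hxy
  | cons a l ih =>
    obtain ⟨z, hz, hzx, hl⟩ := h
    exact ⟨z, hST hz, hzx.trans hxy, ih le_rfl hl⟩

/-- Atoms are idempotent: one copy of the first atom goes below `x`, the other starts the run of
`y`. -/
theorem Run.mul_of_atom_le {S : Set X} {x y : X} {v : GString Sig Θ}
    (hx : K.atom θ v.first ≤ x) (h : Run K θ σ S y v.1 v.2) : Run K θ σ S (x * y) v.1 v.2 := by
  obtain ⟨_ | ⟨⟨α, p⟩, l⟩, β⟩ := v
  · have hx : K.atom θ β ≤ x := hx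
    have h : K.atom θ β ≤ y := h
    change K.atom θ β ≤ x * y
    rw [← K.atom_mul_self θ β]
    exact mul_le_mul' hx h
  · have hx : K.atom θ α ≤ x := hx
    obtain ⟨z, hz, hzy, hl⟩ := h
    refine ⟨z, hz, ?_, hl⟩
    rw [← K.atom_mul_self θ α, mul_assoc (K.atom θ α), mul_assoc (K.atom θ α)]
    exact mul_le_mul' hx hzy

theorem Run.mul {S T : Set X} {x y : X} {l : List (Atom Θ × Sig)} {v : GString Sig Θ}
    (hST : ∀ z ∈ S, z * y ∈ T) (h₁ : Run K θ σ S x l v.first) (h₂ : Run K θ σ T y v.1 v.2) :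
    Run K θ σ T (x * y) (l ++ v.1) v.2 := by
  induction l generalizing x with
  | nil => exact h₂.mul_of_atom_le h₁
  | cons a l ih =>
    obtain ⟨z, hz, hzx, hl⟩ := h₁
    refine ⟨z * y, hST z hz, ?_, ih hl⟩
    rw [← mul_assoc]
    gcongr

variable (K θ σ)

/-- As with Antimirov's partial derivatives: those of a product are those of the left factor times
the right factor, plus those of the right factor; those of a star are those of its body times the
star. -/
theorem exists_finite_run (e : KExpr Sig Θ) :
    ∃ S : Set X, S.Finite ∧ ∀ w ∈ G e, Run K θ σ S (e.eval K θ σ) w.1 w.2 := by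
  induction e with
  | letter p =>
    refine ⟨{1}, Set.finite_singleton 1, ?_⟩
    rintro _ ⟨α, β, rfl⟩
    refine ⟨1, rfl, ?_, K.atom_le_one θ β⟩
    rw [mul_one]
    exact mul_le_of_le_one_left' (K.atom_le_one θ α)
  | test a =>
    refine ⟨∅, Set.finite_empty, ?_⟩
    rintro _ ⟨α, hα, rfl⟩
    exact K.atom_le_test θ α a hα
  | mul e f ihe ihf =>
    obtain ⟨S, hS, he⟩ := ihe
    obtain ⟨T, hT, hf⟩ := ihf
    refine ⟨(· * f.eval K θ σ) '' S ∪ T, (hS.image _).union hT, ?_⟩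
    rintro _ ⟨u, hu, v, hv, h, rfl⟩
    have h : u.2 = v.first := h
    exact Run.mul (fun z hz => .inl ⟨z, hz, rfl⟩) (h ▸ he u hu)
      ((hf v hv).mono Set.subset_union_right le_rfl)
  | add e f ihe ihf =>
    obtain ⟨S, hS, he⟩ := ihe
    obtain ⟨T, hT, hf⟩ := ihf
    refine ⟨S ∪ T, hS.union hT, ?_⟩
    rintro w (hw | hw)
    exacts [(he w hw).mono Set.subset_union_left le_self_add,
      (hf w hw).mono Set.subset_union_right le_add_self]
  | star e ihe =>
    obtain ⟨S, hS, he⟩ := ihe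
    refine ⟨(· * (e.eval K θ σ)∗) '' S, hS.image _, ?_⟩
    rintro w ⟨n, hw⟩
    change w ∈ G e ^ n at hw
    induction n generalizing w with
    | zero =>
      rw [pow_zero] at hw
      obtain ⟨α, rfl⟩ := hw
      exact (K.atom_le_one θ α).trans one_le_kstar
    | succ n ih =>
      rw [pow_succ'] at hw
      obtain ⟨u, hu, v, hv, h, rfl⟩ := hw
      have h : u.2 = v.first := h
      exact (Run.mul (fun z hz => Set.mem_image_of_mem _ hz) (h ▸ he u hu) (ih v hv)).mono
        subset_rfl mul_kstar_le_kstar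
  | one =>
    refine ⟨∅, Set.finite_empty, ?_⟩
    rintro _ ⟨α, rfl⟩
    exact K.atom_le_one θ α
  | zero => exact ⟨∅, Set.finite_empty, fun w hw => hw.elim⟩

end Runs

/-! ### Unfolding an expression along a deterministic automaton -/

open Classical in
/-- The letters occurring in an expression. -/
noncomputable def KExpr.letters {Sig Θ : Type*} : KExpr Sig Θ → Finset Sig
  | .letter p => {p}
  | .mul x y => x.letters ∪ y.letters
  | .add x y => x.letters ∪ y.letters
  | .star x => x.letters
  | _ => ∅

section Unfold

variable {Sig Θ B X D : Type*} [BooleanAlgebra B] [Fintype Θ] [KleeneAlgebra X] [Finite D]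
  {K : KleeneAlgebraWithTests X B} {θ : Θ → B} {σ : Sig → X}
  {δ : D → Atom Θ × Sig → D} {R : D → D → X}

/-- If `R` is reflexive and transitive and contains the transitions of a deterministic automaton
on the letters of `e`, then `e` is covered by the entries of `R` reached by guarded strings
of `e`. -/
theorem mul_eval_mul_le (hone : ∀ d, 1 ≤ R d d) (htrans : ∀ i j k, R i j * R j k ≤ R i k)
    (e : KExpr Sig Θ) (hstep : ∀ d α, ∀ p ∈ e.letters, K.atom θ α * σ p ≤ R d (δ d (α, p)))
    (d : D) (α β : Atom Θ) (z z' c : X)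
    (h : ∀ w ∈ G e, w.first = α → w.2 = β → z * R d (w.1.foldl δ d) * z' ≤ c) :
    z * (K.atom θ α * e.eval K θ σ * K.atom θ β) * z' ≤ c := by
  classical
  -- The arbitrary context `z`, `z'` and bound `c` stand in for a join over the possibly infinite
  -- set `G e`.
  induction e generalizing d α β z z' c with
  | letter p =>
    refine le_trans ?_ (h ([(α, p)], β) ⟨α, β, rfl⟩ rfl rfl)
    gcongr
    exact (mul_le_of_le_one_right' (K.atom_le_one θ β)).trans
      (hstep d α p (Finset.mem_singleton_self p))
  | test a =>
    simp only [KExpr.eval]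
    by_cases hα : α ∈ a.eval (fun t => {α : Atom Θ | α t = true})
    · by_cases hαβ : α = β
      · subst hαβ
        refine le_trans ?_ (h ([], α) ⟨α, hα, rfl⟩ rfl rfl)
        gcongr
        exact (mul_le_one' (mul_le_one' (K.atom_le_one θ α) (K.test_le_one _))
          (K.atom_le_one θ α)).trans (hone d)
      · rw [KleeneAlgebraWithTests.atom, KleeneAlgebraWithTests.atom, ← K.test_inf,
          inf_eq_left.2 ((atomInf_le_eval θ α a).1 hα), ← K.test_inf, atomInf_inf_of_ne θ hαβ,
          K.test_bot]
        simp
    · rw [K.atom_mul_test_of_notMem θ α a hα]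
      simp
  | mul e f ihe ihf =>
    -- Split at the atom `γ` between the factors; by idempotence it both ends the string of `e` and
    -- starts that of `f`.
    have key : z * K.atom θ α * e.eval K θ σ * (f.eval K θ σ * K.atom θ β * z') ≤ c := by
      refine K.mul_le_of_forall_atom θ fun γ => ?_
      have := ihe (fun d α p hp => hstep d α p (Finset.mem_union_left _ hp)) d α γ z
        (K.atom θ γ * f.eval K θ σ * K.atom θ β * z') c fun u hu huα huγ => ?_
      · refine le_of_eq_of_le ?_ this
        nth_rw 1 [← K.atom_mul_self θ γ]
        simp only [mul_assoc]
      · have := ihf (fun d α p hp => hstep d α p (Finset.mem_union_right _ hp))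
          (u.1.foldl δ d) γ β (z * R d (u.1.foldl δ d)) z' c fun v hv hvγ hvβ => ?_
        · refine le_of_eq_of_le ?_ this
          simp only [mul_assoc]
        · have huv : u.2 = v.first := huγ.trans hvγ.symm
          have := h (u.1 ++ v.1, v.2) ⟨u, hu, v, hv, huv, rfl⟩
            (by rw [GString.first_append, ← huv]; exact huα) hvβ
          refine le_trans ?_ this
          rw [mul_assoc z, List.foldl_append]
          gcongr
          exact htrans _ _ _
    refine le_of_eq_of_le ?_ key
    simp only [KExpr.eval, mul_assoc]
  | add e f ihe ihf =>
    simp only [KExpr.eval, mul_add, add_mul]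
    exact add_le
      (ihe (fun d α p hp => hstep d α p (Finset.mem_union_left _ hp)) d α β z z' c
        fun w hw => h w (.inl hw))
      (ihf (fun d α p hp => hstep d α p (Finset.mem_union_right _ hp)) d α β z z' c
        fun w hw => h w (.inr hw))
  | star e ihe =>
    cases nonempty_fintype D
    -- Only the final state and last atom of a string matter, so the join over `G e.star` becomes
    -- the finite sum `T`. It contains `α` and is stable under right multiplication by `e`, so star
    -- induction applies.
    let s : Finset (D × Atom Θ) := Finset.univ.filter fun q =>
      ∃ w ∈ G e.star, w.first = α ∧ w.2 = q.2 ∧ w.1.foldl δ d = q.1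
    let T : X := ∑ q ∈ s, R d q.1 * K.atom θ q.2
    have le_T : ∀ w ∈ G e.star, w.first = α → R d (w.1.foldl δ d) * K.atom θ w.2 ≤ T :=
      fun w hw hwα => le_sum_of_mem (fun q : D × Atom Θ => R d q.1 * K.atom θ q.2)
        (i := (w.1.foldl δ d, w.2)) (by simp only [s, Finset.mem_filter, Finset.mem_univ, true_and]
                                        exact ⟨w, hw, hwα, rfl, rfl⟩)
    have atom_le : K.atom θ α ≤ T :=
      (le_mul_of_one_le_left' (hone d)).trans
        (le_T ([], α) ⟨0, by rw [pow_zero]; exact ⟨α, rfl⟩⟩ rfl)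
    have mul_le : T * e.eval K θ σ ≤ T := by
      rw [Finset.sum_mul]
      refine sum_le_of_forall_le fun q hq => ?_
      obtain ⟨u, ⟨n, hu⟩, huα, huq, hud⟩ := (Finset.mem_filter.1 hq).2
      rw [← mul_one (_ * e.eval K θ σ)]
      refine K.mul_le_of_forall_atom θ fun γ => ?_
      have := ihe hstep q.1 q.2 γ (R d q.1) (K.atom θ γ) T fun v hv hvq hvγ => ?_
      · refine le_of_eq_of_le ?_ this
        nth_rw 1 [← K.atom_mul_self θ γ]
        simp only [mul_assoc, mul_one]
      · have huv : u.2 = v.first := huq.trans hvq.symm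
        have := le_T (u.1 ++ v.1, v.2)
          ⟨n + 1, by rw [pow_succ]; exact ⟨u, hu, v, hv, huv, rfl⟩⟩
          (by rw [GString.first_append, ← huv]; exact huα)
        refine le_trans ?_ this
        rw [List.foldl_append, hud, hvγ]
        gcongr
        exact htrans _ _ _
    have star_le : K.atom θ α * (e.eval K θ σ)∗ ≤ T := mul_kstar_le atom_le mul_le
    calc z * (K.atom θ α * (e.eval K θ σ)∗ * K.atom θ β) * z'
        ≤ z * (T * K.atom θ β) * z' := by gcongr
      _ ≤ c := by
        simp only [T, Finset.sum_mul, Finset.mul_sum]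
        refine sum_le_of_forall_le fun q hq => ?_
        obtain ⟨w, hw, hwα, hwq, hwd⟩ := (Finset.mem_filter.1 hq).2
        by_cases hqβ : q.2 = β
        · refine le_trans ?_ (h w hw hwα (hwq.trans hqβ))
          rw [hwd, mul_assoc (R d q.1)]
          gcongr
          exact mul_le_of_le_one_right' (mul_le_one' (K.atom_le_one θ _) (K.atom_le_one θ _))
        · rw [mul_assoc (R d q.1), K.atom_mul_of_ne θ hqβ]
          simp
  | one =>
    simp only [KExpr.eval, mul_one]
    by_cases hαβ : α = β
    · subst hαβ
      refine le_trans ?_ (h ([], α) ⟨α, rfl⟩ rfl rfl)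
      gcongr
      exact (mul_le_one' (K.atom_le_one θ α) (K.atom_le_one θ α)).trans (hone d)
    · rw [K.atom_mul_of_ne θ hαβ]
      simp
  | zero => simp [KExpr.eval]

end Unfold

/-! ### Completeness -/

section Completeness

variable {Sig Θ B X : Type*} [BooleanAlgebra B] [Fintype Θ] [KleeneAlgebra X]
  (K : KleeneAlgebraWithTests X B) (θ : Θ → B) (σ : Sig → X)

open Classical in
/-- The deterministic automaton on finite sets of elements of `S`, obtained by the powerset
construction from the transitions used in `Run`. -/
noncomputable def derivStep (S : Finset X) (d : Finset S) (a : Atom Θ × Sig) : Finset S :=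
  Finset.univ.filter fun y => ∃ x ∈ d, K.atom θ a.1 * σ a.2 * y ≤ x

variable {K θ σ}

theorem mem_derivStep {S : Finset X} {d : Finset S} {a : Atom Θ × Sig} {y : S} :
    y ∈ derivStep K θ σ S d a ↔ ∃ x ∈ d, K.atom θ a.1 * σ a.2 * y ≤ x := by
  simp [derivStep]

/-- This is the inequality `N v ≤ v` for the vector of sums of states. -/
theorem mul_sum_derivStep_le (S : Finset X) (d : Finset S) (a : Atom Θ × Sig) :
    K.atom θ a.1 * σ a.2 * ∑ y ∈ derivStep K θ σ S d a, (y : X) ≤ ∑ x ∈ d, (x : X) := by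
  rw [Finset.mul_sum]
  refine sum_le_of_forall_le fun y hy => ?_
  obtain ⟨x, hx, hyx⟩ := mem_derivStep.1 hy
  exact hyx.trans (le_sum_of_mem (fun x : S => (x : X)) hx)

theorem Run.atom_le_sum_foldl {S : Finset X} {d : Finset S} {x : S} (hx : x ∈ d)
    {l : List (Atom Θ × Sig)} {β : Atom Θ} (h : Run K θ σ (S : Set X) x l β) :
    K.atom θ β ≤ ∑ y ∈ l.foldl (derivStep K θ σ S) d, (y : X) := by
  induction l generalizing d x with
  | nil => exact le_trans h (le_sum_of_mem (fun x : S => (x : X)) hx)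
  | cons a l ih =>
    obtain ⟨y, hy, hyx, hl⟩ := h
    exact ih (x := ⟨y, hy⟩) (mem_derivStep.2 ⟨x, hx, hyx⟩) hl

variable (K θ σ)

theorem eval_le_eval_of_G_le {x y : KExpr Sig Θ} (hxy : G x ≤ G y) :
    x.eval K θ σ ≤ y.eval K θ σ := by
  classical
  obtain ⟨S₀, hS₀, hrun⟩ := exists_finite_run K θ σ y
  -- The value of `y` is added so that `{y₀}` can be the start state.
  let S : Finset X := insert (y.eval K θ σ) hS₀.toFinset
  have hS : S₀ ⊆ S := fun z hz => by simp [S, hz]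
  let y₀ : S := ⟨y.eval K θ σ, Finset.mem_insert_self _ _⟩
  let δ := derivStep K θ σ S
  -- Restricting to the letters of `x` keeps the sum finite when `Sig` is infinite.
  let N : Finset S → Finset S → X := fun d d' =>
    ∑ a ∈ (Finset.univ ×ˢ x.letters).filter fun a => δ d a = d', K.atom θ a.1 * σ a.2
  obtain ⟨R, hone, hN, htrans, hleast⟩ := exists_reflTransClosure N
  have hstep : ∀ d α, ∀ p ∈ x.letters, K.atom θ α * σ p ≤ R d (δ d (α, p)) := fun d α p hp =>
    le_trans (le_sum_of_mem (fun a : Atom Θ × Sig => K.atom θ a.1 * σ a.2) (i := (α, p))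
      (by simp [hp])) (hN d (δ d (α, p)))
  have hR : ∀ d, R {y₀} d * ∑ z ∈ d, (z : X) ≤ y.eval K θ σ := fun d => by
    have := hleast (fun d => ∑ z ∈ d, (z : X)) (fun d d' => ?_) {y₀} d
    · simpa [y₀] using this
    · rw [Finset.sum_mul]
      refine sum_le_of_forall_le fun a ha => ?_
      obtain rfl := (Finset.mem_filter.1 ha).2
      exact mul_sum_derivStep_le S d a
  rw [← one_mul (x.eval K θ σ)]
  refine K.mul_le_of_forall_atom θ fun α => ?_
  rw [← mul_one (_ * x.eval K θ σ)]
  refine K.mul_le_of_forall_atom θ fun β => ?_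
  -- The second copy of `β` is kept as right context, to be bounded by the sum of the state reached.
  have := mul_eval_mul_le hone htrans x hstep {y₀} α β 1 (K.atom θ β) (y.eval K θ σ)
    fun w hw _ hwβ => ?_
  · refine le_of_eq_of_le ?_ this
    nth_rw 1 [← K.atom_mul_self θ β]
    simp only [mul_assoc, mul_one, one_mul]
  · rw [one_mul]
    refine le_trans ?_ (hR (w.1.foldl δ {y₀}))
    gcongr
    rw [← hwβ]
    exact Run.atom_le_sum_foldl (Finset.mem_singleton_self y₀)
      ((hrun w (GLang.le_def.1 hxy w hw)).mono hS le_rfl)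

end Completeness

end KAT

theorem mainTheorem1 {Sig : Type u} {Θ : Type v} [Finite Θ]
    (x y : KAT.KExpr Sig Θ) (h : KAT.G x = KAT.G y) :
    KAT.IsTheorem.{u, v, w, z} x y := by
  intro X B _ _ K θ σ
  cases nonempty_fintype Θ
  exact le_antisymm (KAT.eval_le_eval_of_G_le K θ σ h.le) (KAT.eval_le_eval_of_G_le K θ σ h.ge)
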